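/- For polynomials $f,g\in\mathbb{R}[q]$ write $f\geq_q g$ if every coefficient of $f-g$ is nonnegative; $f$ is called $q$-nonnegative if $f\ge_q 0$. Given sequences $r=(r_k)_{k\ge0}$, $s=(s_k)_{k\ge0}$, $t=(t_k)_{k\ge1}$ in $\mathbb{R}[q]$, the Catalan–Stieltjes matrix $(c_{n,k})_{n,k\ge0}$ is defined by $c_{0,0}=1$, $c_{0,k}=0$ for $k\ge1$, and, for $n\ge1$, $c_{n,0}=s_0c_{n-1,0}+t_1c_{n-1,1}$ and $c_{n,k}=r_{k-1}c_{n-1,k-1}+s_kc_{n-1,k}+t_{k+1}c_{n-1,k+1}$ for $k\ge1$. Its Catalan-like numbers are $c_{n,0}$, $n\ge0$. Consider the following conditions on $r,s,t$. - (A) $s_0\ge_q r_0$, and $s_k\ge_q r_k+t_k$ for $k\ge1$. - (B) $s_0\ge_q t_1$, and $s_k\ge_q r_{k-1}+t_{k+1}$ for $k\ge1$. - (C) $s_0\ge_q r_0t_1$, and $s_k\ge_q r_kt_{k+1}+1$ for $k\ge1$. - (D) There are $q$-nonnegative polynomials $b_k,c_k$ $(k\ge 0)$ with $r_k=1$, $s_k=b_k+c_k$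 and $t_{k+1}=b_{k+1}c_k$ for all $k\ge0$. Then each of the following three families $(P_n(q))_{n\ge0}$ is the sequence of Catalan-like numbers of the indicated Catalan–Stieltjes matrix, whose parameters are all $q$-nonnegative and satisfy the indicated conditions. - **Eulerian polynomials** $E_n(q)$, defined by $\sum_{k\ge0}(k+1)^nq^k=\dfrac{E_n(q)}{(1-q)^{n+1}}$: here $r_k=k+1$, $s_k=k(q+1)+1$, $t_{k+1}=(k+1)q$ for $k\ge0$, and condition (A) holds. - **Schröder polynomials** $R_n(q)=\sum_{k=0}^n\binom{n+k}{n-k}\frac1{k+1}\binom{2k}{k}q^k$: here $r_k=1$ for $k\ge0$, $s_0=q+1$, $s_k=2q+1$ and $t_k=q(q+1)$ for $k\ge1$, and condition (D) holds. - **Narayana polynomials of type A**, $N_0(q)=1$ and $N_n(q)=\sum_{k=1}^n\frac1n\binom n{k-1}\binom nk q^k$ for $n\ge1$: here $r_k=1$ for $k\ge0$, $s_0=q$, $s_k=q+1$ and $t_k=q$ for $k\ge1$, and conditions (B), (C) and (D) hold. Moreover, for each of the families $P_n=E_n$, $P_n=R_n$, $P_n=N_n$ and all integers $0\le i<j<k$,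 $$P_{2i}P_{j+k}^2+P_{2j}P_{i+k}^2+P_{2k}P_{i+j}^2-3P_{i+j}P_{j+k}P_{k+i}\ \geq_q\ 0.$$ -/

import Mathlib

open Polynomial

/-- The entries `c n k` of the Catalan-Stieltjes matrix with parameters `r = (r_k)_{k ≥ 0}`,
`s = (s_k)_{k ≥ 0}` and `t = (t_k)_{k ≥ 1}` (the value `t 0` is never used). The `0`-th row is
`1, 0, 0, …`, so the matrix is lower triangular. -/
def catalanStieltjes {R : Type*} [CommRing R] (r s t : ℕ → R) : ℕ → ℕ → R
  | 0, 0 => 1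
  | 0, _ + 1 => 0
  | n + 1, 0 =>
      s 0 * catalanStieltjes r s t n 0 + t 1 * catalanStieltjes r s t n 1
  | n + 1, k + 1 =>
      r k * catalanStieltjes r s t n k + s (k + 1) * catalanStieltjes r s t n (k + 1)
        + t (k + 2) * catalanStieltjes r s t n (k + 2)

/-- The Catalan-Stieltjes matrix is lower triangular. -/
theorem catalanStieltjes_eq_zero_of_lt {R : Type*} [CommRing R] (r s t : ℕ → R) :
    ∀ n k : ℕ, n < k → catalanStieltjes r s t n k = 0 := by
  intro n
  induction n with
  | zero =>
    intro k hk
    obtain ⟨m, rfl⟩ : ∃ m, k = m + 1 := ⟨k - 1, by omega⟩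
    simp [catalanStieltjes]
  | succ n ih =>
    intro k hk
    obtain ⟨m, rfl⟩ : ∃ m, k = m + 1 := ⟨k - 1, by omega⟩
    simp [catalanStieltjes, ih m (by omega), ih (m + 1) (by omega), ih (m + 2) (by omega)]

/-- The Catalan-like numbers: the column `k = 0` of the Catalan-Stieltjes matrix. -/
def catalanLike {R : Type*} [CommRing R] (r s t : ℕ → R) (n : ℕ) : R :=
  catalanStieltjes r s t n 0

/-- A polynomial in `q` is `q`-nonnegative if all its coefficients are nonnegative. -/
def QNonneg (f : ℝ[X]) : Prop := ∀ m : ℕ, 0 ≤ f.coeff m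

/-- `QGe f g` is the relation `f ≥_q g`: the difference `f - g` is `q`-nonnegative. -/
def QGe (f g : ℝ[X]) : Prop := QNonneg (f - g)

/-- The three parameter sequences consist of `q`-nonnegative polynomials. -/
def QNonnegParams (r s t : ℕ → ℝ[X]) : Prop :=
  (∀ k, QNonneg (r k)) ∧ (∀ k, QNonneg (s k)) ∧ (∀ k, 1 ≤ k → QNonneg (t k))

/-- `s_0 ≥_q r_0`, and `s_k ≥_q r_k + t_k` for `k ≥ 1`. -/
def PositivityConditionA (r s t : ℕ → ℝ[X]) : Prop :=
  QGe (s 0) (r 0) ∧ ∀ k, 1 ≤ k → QGe (s k) (r k + t k)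

/-- `s_0 ≥_q t_1`, and `s_k ≥_q r_{k-1} + t_{k+1}` for `k ≥ 1`. -/
def PositivityConditionB (r s t : ℕ → ℝ[X]) : Prop :=
  QGe (s 0) (t 1) ∧ ∀ k, 1 ≤ k → QGe (s k) (r (k - 1) + t (k + 1))

/-- `s_0 ≥_q r_0 t_1`, and `s_k ≥_q r_k t_{k+1} + 1` for `k ≥ 1`. -/
def PositivityConditionC (r s t : ℕ → ℝ[X]) : Prop :=
  QGe (s 0) (r 0 * t 1) ∧ ∀ k, 1 ≤ k → QGe (s k) (r k * t (k + 1) + 1)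

/-- There are `q`-nonnegative polynomials `b_k`, `c_k` with `r_k = 1`, `s_k = b_k + c_k` and
`t_{k+1} = b_{k+1} c_k` for all `k ≥ 0`. -/
def PositivityConditionD (r s t : ℕ → ℝ[X]) : Prop :=
  ∃ b c : ℕ → ℝ[X], (∀ k, QNonneg (b k)) ∧ (∀ k, QNonneg (c k)) ∧
    ∀ k, r k = 1 ∧ s k = b k + c k ∧ t (k + 1) = b (k + 1) * c k

/-- There is a polynomial `E` with `(∑_{k ≥ 0} (k+1)^n q^k) (1-q)^{n+1} = E`, as formal power
series. -/
theorem exists_eulerianPoly (n : ℕ) : ∃ E : ℝ[X],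
    (PowerSeries.mk fun k : ℕ => ((k : ℝ) + 1) ^ n) * (1 - PowerSeries.X) ^ (n + 1)
      = (E : PowerSeries ℝ) := by
  induction n with
  | zero =>
    refine ⟨1, ?_⟩
    have h := PowerSeries.mk_one_mul_one_sub_eq_one ℝ
    simp only [pow_zero, zero_add, pow_one, Polynomial.coe_one]
    exact h
  | succ n ih =>
    obtain ⟨E, hE⟩ := ih
    refine ⟨E * (1 - X) + X * (derivative E * (1 - X) + ((n : ℝ[X]) + 1) * E), ?_⟩
    set A : PowerSeries ℝ := PowerSeries.mk fun k : ℕ => ((k : ℝ) + 1) ^ n with hA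
    have h1 : (PowerSeries.mk fun k : ℕ => ((k : ℝ) + 1) ^ (n + 1))
        = A + PowerSeries.X * PowerSeries.derivative ℝ A := by
      ext k
      cases k with
      | zero => simp [hA]
      | succ m =>
        simp [hA, PowerSeries.coeff_succ_X_mul, PowerSeries.coeff_derivative]
        ring
    have h2 := congrArg (PowerSeries.derivative ℝ) hE
    rw [PowerSeries.derivative_coe] at h2
    simp only [Derivation.leibniz, Derivation.leibniz_pow, map_sub, Derivation.map_one_eq_zero,
      PowerSeries.derivative_X, smul_eq_mul, nsmul_eq_mul, Nat.add_sub_cancel] at h2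
    have h3 : (((n : ℝ[X]) : ℝ[X]) : PowerSeries ℝ) = (n : PowerSeries ℝ) :=
      map_natCast (Polynomial.coeToPowerSeries.ringHom (R := ℝ)) n
    rw [h1]
    push_cast at h2 ⊢
    rw [h3, ← h2, ← hE]
    ring

/-- The Eulerian polynomial `E_n(q)`: the polynomial with
`∑_{k ≥ 0} (k+1)^n q^k = E_n(q) / (1-q)^{n+1}`. -/
noncomputable def eulerianPoly (n : ℕ) : ℝ[X] := Classical.choose (exists_eulerianPoly n)

/-- The identity that determines `E_n(q)`. -/
theorem eulerianPoly_spec (n : ℕ) :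
    (PowerSeries.mk fun k : ℕ => ((k : ℝ) + 1) ^ n) * (1 - PowerSeries.X) ^ (n + 1)
      = (eulerianPoly n : PowerSeries ℝ) :=
  Classical.choose_spec (exists_eulerianPoly n)

/-- The Schröder polynomial
`R_n(q) = ∑_{k=0}^n binom(n+k, n-k) (1/(k+1)) binom(2k, k) q^k`. -/
noncomputable def schroderPoly (n : ℕ) : ℝ[X] :=
  ∑ k ∈ Finset.range (n + 1),
    C (((n + k).choose (n - k) : ℝ) * (1 / ((k : ℝ) + 1)) * ((2 * k).choose k : ℝ)) * X ^ k

/-- The Narayana polynomial of type A: `N_0(q) = 1`, and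
`N_n(q) = ∑_{k=1}^n (1/n) binom(n, k-1) binom(n, k) q^k` for `n ≥ 1`. -/
noncomputable def narayanaPoly (n : ℕ) : ℝ[X] :=
  if n = 0 then 1
  else ∑ k ∈ Finset.Icc 1 n,
    C ((1 / (n : ℝ)) * (n.choose (k - 1) : ℝ) * (n.choose k : ℝ)) * X ^ k

/-- The three-term inequality
`P_{2i} P_{j+k}^2 + P_{2j} P_{i+k}^2 + P_{2k} P_{i+j}^2 - 3 P_{i+j} P_{j+k} P_{k+i} ≥_q 0`
for all `0 ≤ i < j < k`. -/
def ThreeTermInequality (P : ℕ → ℝ[X]) : Prop :=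
  ∀ i j k : ℕ, i < j → j < k →
    QGe (P (2 * i) * P (j + k) ^ 2 + P (2 * j) * P (i + k) ^ 2 + P (2 * k) * P (i + j) ^ 2
      - 3 * P (i + j) * P (j + k) * P (k + i)) 0

/-- Parameters of the Eulerian polynomials: `r_k = k + 1`. -/
noncomputable def eulerianR (k : ℕ) : ℝ[X] := (k : ℝ[X]) + 1

/-- Parameters of the Eulerian polynomials: `s_k = k (q + 1) + 1`. -/
noncomputable def eulerianS (k : ℕ) : ℝ[X] := (k : ℝ[X]) * (X + 1) + 1

/-- Parameters of the Eulerian polynomials: `t_{k+1} = (k + 1) q`, that is, `t_k = k q`. -/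
noncomputable def eulerianT (k : ℕ) : ℝ[X] := (k : ℝ[X]) * X

/-- Parameters of the Schröder polynomials: `r_k = 1`. -/
noncomputable def schroderR (_ : ℕ) : ℝ[X] := 1

/-- Parameters of the Schröder polynomials: `s_0 = q + 1` and `s_k = 2q + 1` for `k ≥ 1`. -/
noncomputable def schroderS (k : ℕ) : ℝ[X] := if k = 0 then X + 1 else 2 * X + 1

/-- Parameters of the Schröder polynomials: `t_k = q (q + 1)` for `k ≥ 1`. -/
noncomputable def schroderT (_ : ℕ) : ℝ[X] := X * (X + 1)

/-- Parameters of the Narayana polynomials: `r_k = 1`. -/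
noncomputable def narayanaR (_ : ℕ) : ℝ[X] := 1

/-- Parameters of the Narayana polynomials: `s_0 = q` and `s_k = q + 1` for `k ≥ 1`. -/
noncomputable def narayanaS (k : ℕ) : ℝ[X] := if k = 0 then X else X + 1

/-- Parameters of the Narayana polynomials: `t_k = q` for `k ≥ 1`. -/
noncomputable def narayanaT (_ : ℕ) : ℝ[X] := X

/-! Let T be the tridiagonal matrix of the parameters, so that row n of the Catalan–Stieltjes matrix
is e_0 T^n. If w_0 = 1 and w_{k+1} r_k = w_k t_{k+1}, then T is self-adjoint for the form ∑ w_l u_l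
v_l, and P_{m+n} is the product of rows m and n (`sum_catalanStieltjes_mul`). Write u, v, x for rows
i, j, k and G for their Gram matrix. The three-term expression equals [G_uu (G_vv G_xx - G_vx²) -
det G] + [G_xx (G_uu G_vv - G_uv²) - det G] + G_ux (G_uv G_vx - G_ux G_vv).

By Cauchy–Binet each bracket is a weighted sum over column sets of products of row minors. The last
is q-nonnegative once the minors of order two are. The first two need more: at columns l < m < n the
minor of order three must be bounded by u_l times the (m, n) minor of v, x, and by x_n times the (l,
m) minor of u, v. `BidiagonalFactorization.dominatedMinors` supplies these bounds: for each family T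
is a product of two q-nonnegative bidiagonal matrices, and such factors preserve them.

The families are identified by a differential recurrence (Eulerian) and by coefficients of ((z +
b)(z + c))^n (Schröder, Narayana). -/

/-! ### q-nonnegative polynomials -/

theorem QNonneg.add {f g : ℝ[X]} (hf : QNonneg f) (hg : QNonneg g) : QNonneg (f + g) := fun m => by
  rw [coeff_add]; exact add_nonneg (hf m) (hg m)

theorem QNonneg.mul {f g : ℝ[X]} (hf : QNonneg f) (hg : QNonneg g) : QNonneg (f * g) := fun m => by
  rw [coeff_mul]; exact Finset.sum_nonneg fun p _ => mul_nonneg (hf _) (hg _)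

theorem QNonneg.zero : QNonneg 0 := fun m => by simp

theorem QNonneg.one : QNonneg 1 := fun m => by
  rw [coeff_one]; split_ifs <;> norm_num

theorem QNonneg.X : QNonneg (X : ℝ[X]) := fun m => by
  rw [coeff_X]; split_ifs <;> norm_num

theorem QNonneg.natCast (n : ℕ) : QNonneg (n : ℝ[X]) := by
  induction n with
  | zero => simpa using QNonneg.zero
  | succ n ih => simpa using ih.add QNonneg.one

theorem QNonneg.pow {f : ℝ[X]} (hf : QNonneg f) (n : ℕ) : QNonneg (f ^ n) := by
  induction n with
  | zero => simpa using QNonneg.one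
  | succ n ih => simpa [pow_succ] using ih.mul hf

theorem QNonneg.sum {ι : Type*} {s : Finset ι} {f : ι → ℝ[X]} (h : ∀ i, QNonneg (f i)) :
    QNonneg (∑ i ∈ s, f i) := fun m => by
  rw [finsetSum_coeff]; exact Finset.sum_nonneg fun i _ => h i m

theorem QNonneg.of_natCast_mul {n : ℕ} (hn : 0 < n) {f : ℝ[X]} (h : QNonneg ((n : ℝ[X]) * f)) :
    QNonneg f := fun m => by
  have := h m
  rw [← C_eq_natCast, coeff_C_mul] at this
  exact nonneg_of_mul_nonneg_right this (by exact_mod_cast hn)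

theorem qGe_self (f : ℝ[X]) : QGe f f := by
  unfold QGe; rw [sub_self]; exact QNonneg.zero

/-! ### Minors under bidiagonal maps -/

/-- The minor of the rows `u`, `v` in the columns `l`, `m`. -/
def minorTwo {R : Type*} [CommRing R] (u v : ℕ → R) (l m : ℕ) : R := u l * v m - u m * v l

/-- The minor of the rows `u`, `v`, `w` in the columns `l`, `m`, `n`. -/
def minorThree {R : Type*} [CommRing R] (u v w : ℕ → R) (l m n : ℕ) : R :=
  u l * minorTwo v w m n - u m * minorTwo v w l n + u n * minorTwo v w l m

/-- All minors of order two of the rows `u`, `v` are `q`-nonnegative. -/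
def QNonnegMinors (u v : ℕ → ℝ[X]) : Prop := ∀ l m, l ≤ m → QNonneg (minorTwo u v l m)

/-- The minors of order three of the rows `u`, `v`, `w` are `q`-nonnegative and bounded by the
products of complementary diagonal minors. -/
def DominatedMinors (u v w : ℕ → ℝ[X]) : Prop := ∀ l m n, l ≤ m → m ≤ n →
  QNonneg (minorThree u v w l m n) ∧
  QNonneg (u l * minorTwo v w m n - minorThree u v w l m n) ∧
  QNonneg (w n * minorTwo u v l m - minorThree u v w l m n)

/-- The action on row vectors of a matrix with two nonzero entries in each column. -/
def bidiagonal {R : Type*} [CommRing R] (α β : ℕ → R) (φ ψ : ℕ → ℕ) (u : ℕ → R) (l : ℕ) : R :=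
  α l * u (φ l) + β l * u (ψ l)

theorem QNonnegMinors.of_lt {u v : ℕ → ℝ[X]}
    (h : ∀ l m, l < m → QNonneg (minorTwo u v l m)) : QNonnegMinors u v := by
  intro l m hlm
  rcases hlm.eq_or_lt with rfl | hlm
  · simpa [minorTwo] using QNonneg.zero
  · exact h l m hlm

/-- A repeated column kills the minor of order three, and both bounds become products of
q-nonnegative factors. -/
theorem DominatedMinors.of_lt {u v w : ℕ → ℝ[X]} (hu : ∀ l, QNonneg (u l))
    (hw : ∀ l, QNonneg (w l)) (huv : QNonnegMinors u v) (hvw : QNonnegMinors v w)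
    (h : ∀ l m n, l < m → m < n →
      QNonneg (minorThree u v w l m n) ∧
      QNonneg (u l * minorTwo v w m n - minorThree u v w l m n) ∧
      QNonneg (w n * minorTwo u v l m - minorThree u v w l m n)) : DominatedMinors u v w := by
  intro l m n hlm hmn
  by_cases hs : l < m ∧ m < n
  · exact h l m n hs.1 hs.2
  · have h0 : minorThree u v w l m n = 0 := by
      rcases hlm.eq_or_lt with rfl | h1
      · simp only [minorThree, minorTwo]; ring
      · obtain rfl : m = n := by omega
        simp only [minorThree, minorTwo]; ring
    rw [h0, sub_zero, sub_zero]
    exact ⟨QNonneg.zero, (hu l).mul (hvw m n hmn), (hw n).mul (huv l m hlm)⟩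

section Bidiagonal

variable {α β : ℕ → ℝ[X]} {φ ψ : ℕ → ℕ}

theorem QNonneg.bidiagonal (hα : ∀ l, QNonneg (α l)) (hβ : ∀ l, QNonneg (β l))
    {u : ℕ → ℝ[X]} (hu : ∀ l, QNonneg (u l)) (l : ℕ) : QNonneg (bidiagonal α β φ ψ u l) :=
  ((hα l).mul (hu _)).add ((hβ l).mul (hu _))

/-- The order hypothesis sends columns l < m only to weakly increasing pairs, so the bilinear
expansion contains no minor with reversed columns and hence no negative term. -/
theorem QNonnegMinors.bidiagonal (hα : ∀ l, QNonneg (α l)) (hβ : ∀ l, QNonneg (β l))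
    (h : ∀ l m, l < m → φ l ≤ φ m ∧ φ l ≤ ψ m ∧ ψ l ≤ φ m ∧ ψ l ≤ ψ m)
    {u v : ℕ → ℝ[X]} (huv : QNonnegMinors u v) :
    QNonnegMinors (bidiagonal α β φ ψ u) (bidiagonal α β φ ψ v) := by
  refine .of_lt fun l m hlm => ?_
  obtain ⟨h1, h2, h3, h4⟩ := h l m hlm
  have key : minorTwo (_root_.bidiagonal α β φ ψ u) (_root_.bidiagonal α β φ ψ v) l m =
      α l * α m * minorTwo u v (φ l) (φ m) + α l * β m * minorTwo u v (φ l) (ψ m)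
      + β l * α m * minorTwo u v (ψ l) (φ m) + β l * β m * minorTwo u v (ψ l) (ψ m) := by
    simp only [minorTwo, _root_.bidiagonal]; ring
  rw [key]
  exact (((((hα l).mul (hα m)).mul (huv _ _ h1)).add (((hα l).mul (hβ m)).mul (huv _ _ h2))).add
    (((hβ l).mul (hα m)).mul (huv _ _ h3))).add (((hβ l).mul (hβ m)).mul (huv _ _ h4))

/-- A function which is affine in each of three columns is `q`-nonnegative after a bidiagonal map
if it was before. -/
theorem qNonneg_of_expansion (hα : ∀ l, QNonneg (α l)) (hβ : ∀ l, QNonneg (β l))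
    (h : ∀ l m, l < m → φ l ≤ φ m ∧ φ l ≤ ψ m ∧ ψ l ≤ φ m ∧ ψ l ≤ ψ m)
    {F : ℕ → ℕ → ℕ → ℝ[X]} (hF : ∀ l m n, l ≤ m → m ≤ n → QNonneg (F l m n)) {f : ℝ[X]}
    {l m n : ℕ} (hlm : l < m) (hmn : m < n)
    (hf : f = α l * α m * α n * F (φ l) (φ m) (φ n) + α l * α m * β n * F (φ l) (φ m) (ψ n)
      + α l * β m * α n * F (φ l) (ψ m) (φ n) + α l * β m * β n * F (φ l) (ψ m) (ψ n)
      + β l * α m * α n * F (ψ l) (φ m) (φ n) + β l * α m * β n * F (ψ l) (φ m) (ψ n)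
      + β l * β m * α n * F (ψ l) (ψ m) (φ n) + β l * β m * β n * F (ψ l) (ψ m) (ψ n)) :
    QNonneg f := by
  obtain ⟨h1, h2, h3, h4⟩ := h l m hlm
  obtain ⟨k1, k2, k3, k4⟩ := h m n hmn
  rw [hf]
  have a := hα l; have a' := hα m; have a'' := hα n
  have b := hβ l; have b' := hβ m; have b'' := hβ n
  exact ((((((((a.mul a').mul a'').mul (hF _ _ _ h1 k1)).add
    (((a.mul a').mul b'').mul (hF _ _ _ h1 k2))).add
    (((a.mul b').mul a'').mul (hF _ _ _ h2 k3))).add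
    (((a.mul b').mul b'').mul (hF _ _ _ h2 k4))).add
    (((b.mul a').mul a'').mul (hF _ _ _ h3 k1))).add
    (((b.mul a').mul b'').mul (hF _ _ _ h3 k2))).add
    (((b.mul b').mul a'').mul (hF _ _ _ h4 k3)) |>.add
    (((b.mul b').mul b'').mul (hF _ _ _ h4 k4))

theorem DominatedMinors.bidiagonal (hα : ∀ l, QNonneg (α l)) (hβ : ∀ l, QNonneg (β l))
    (h : ∀ l m, l < m → φ l ≤ φ m ∧ φ l ≤ ψ m ∧ ψ l ≤ φ m ∧ ψ l ≤ ψ m)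
    {u v w : ℕ → ℝ[X]} (hu : ∀ l, QNonneg (u l)) (hw : ∀ l, QNonneg (w l))
    (huv : QNonnegMinors u v) (hvw : QNonnegMinors v w) (huvw : DominatedMinors u v w) :
    DominatedMinors (bidiagonal α β φ ψ u) (bidiagonal α β φ ψ v) (bidiagonal α β φ ψ w) := by
  refine .of_lt (QNonneg.bidiagonal hα hβ hu) (QNonneg.bidiagonal hα hβ hw)
    (huv.bidiagonal hα hβ h) (hvw.bidiagonal hα hβ h) fun l m n hlm hmn => ⟨?_, ?_, ?_⟩
  -- The minor of order three and both differences use each column exactly once in every monomial,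
  -- so all three expand in the same way.
  · refine qNonneg_of_expansion hα hβ h (fun l m n h h' => (huvw l m n h h').1) hlm hmn ?_
    simp only [minorThree, minorTwo, _root_.bidiagonal]; ring
  · refine qNonneg_of_expansion hα hβ h (fun l m n h h' => (huvw l m n h h').2.1) hlm hmn ?_
    simp only [minorThree, minorTwo, _root_.bidiagonal]; ring
  · refine qNonneg_of_expansion hα hβ h (fun l m n h h' => (huvw l m n h h').2.2) hlm hmn ?_
    simp only [minorThree, minorTwo, _root_.bidiagonal]; ring

end Bidiagonal

/-! ### Rows of a matrix with a bidiagonal factorization -/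

/-- The tridiagonal matrix with parameters `r`, `s`, `t` is a product of a lower bidiagonal matrix
with entries `α`, `β` and an upper bidiagonal matrix with entries `γ`, `δ`, all of them
`q`-nonnegative. -/
structure BidiagonalFactorization (r s t α β γ δ : ℕ → ℝ[X]) : Prop where
  qNonneg_lower_diag : ∀ k, QNonneg (α k)
  qNonneg_lower : ∀ k, QNonneg (β k)
  qNonneg_upper_diag : ∀ k, QNonneg (γ k)
  qNonneg_upper : ∀ k, QNonneg (δ k)
  r_eq : ∀ k, r k = α k * δ k
  s_zero : s 0 = α 0 * γ 0
  s_succ : ∀ k, s (k + 1) = α (k + 1) * γ (k + 1) + β k * δ k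
  t_succ : ∀ k, t (k + 1) = β k * γ k

namespace BidiagonalFactorization

variable {r s t α β γ δ : ℕ → ℝ[X]}

theorem row_succ (h : BidiagonalFactorization r s t α β γ δ) (n : ℕ) :
    catalanStieltjes r s t (n + 1) =
      -- Column 0 has no superdiagonal entry: its coefficient is 0, so the truncated index `0 - 1 =
      -- 0` does no harm.
      bidiagonal γ (fun k => if k = 0 then 0 else δ (k - 1)) id (· - 1)
        (bidiagonal α β id (· + 1) (catalanStieltjes r s t n)) := by
  funext k
  cases k with
  | zero =>
    simp only [catalanStieltjes, bidiagonal, h.s_zero, h.t_succ 0, id, if_true]; ring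
  | succ k =>
    simp only [catalanStieltjes, bidiagonal, h.s_succ, h.t_succ (k + 1), h.r_eq, id,
      Nat.add_sub_cancel, Nat.add_eq_zero_iff, one_ne_zero, and_false, if_false]
    ring

theorem qNonneg_shifted (h : BidiagonalFactorization r s t α β γ δ) (k : ℕ) :
    QNonneg (if k = 0 then 0 else δ (k - 1)) := by
  split_ifs
  exacts [QNonneg.zero, h.qNonneg_upper _]

theorem row_zero (k : ℕ) : catalanStieltjes r s t 0 k = if k = 0 then 1 else 0 := by
  cases k <;> simp [catalanStieltjes]

theorem qNonneg (h : BidiagonalFactorization r s t α β γ δ) (n : ℕ) :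
    ∀ k, QNonneg (catalanStieltjes r s t n k) := by
  induction n with
  | zero =>
    intro k
    rw [row_zero]
    split_ifs
    exacts [QNonneg.one, QNonneg.zero]
  | succ n ih =>
    rw [h.row_succ]
    exact QNonneg.bidiagonal h.qNonneg_upper_diag h.qNonneg_shifted
      (QNonneg.bidiagonal h.qNonneg_lower_diag h.qNonneg_lower ih)

/-- Removing one factor T from both rows lowers both indices, until the upper row is e_0 and the
minor is a product of entries. -/
theorem qNonnegMinors (h : BidiagonalFactorization r s t α β γ δ) (i j : ℕ) (hij : i < j) :
    QNonnegMinors (catalanStieltjes r s t i) (catalanStieltjes r s t j) := by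
  induction i generalizing j with
  | zero =>
    refine .of_lt fun l m hlm => ?_
    have hm : m ≠ 0 := by omega
    rw [minorTwo, row_zero, row_zero, if_neg hm, zero_mul, sub_zero]
    split_ifs
    · rw [one_mul]; exact h.qNonneg _ _
    · rw [zero_mul]; exact QNonneg.zero
  | succ i ih =>
    obtain ⟨j, rfl⟩ : ∃ j', j = j' + 1 := ⟨j - 1, by omega⟩
    rw [h.row_succ, h.row_succ]
    refine QNonnegMinors.bidiagonal h.qNonneg_upper_diag h.qNonneg_shifted
      (fun l m hlm => by simp only [id]; omega) ?_
    exact QNonnegMinors.bidiagonal h.qNonneg_lower_diag h.qNonneg_lower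
      (fun l m hlm => by simp only [id]; omega) (ih j (by omega))

theorem dominatedMinors (h : BidiagonalFactorization r s t α β γ δ) (i j k : ℕ) (hij : i < j)
    (hjk : j < k) :
    DominatedMinors (catalanStieltjes r s t i) (catalanStieltjes r s t j)
      (catalanStieltjes r s t k) := by
  induction i generalizing j k with
  | zero =>
    refine .of_lt (h.qNonneg _) (h.qNonneg _) (h.qNonnegMinors _ _ hij) (h.qNonnegMinors _ _ hjk)
      fun l m n hlm hmn => ?_
    have hm : m ≠ 0 := by omega
    have hn : n ≠ 0 := by omega
    -- The top row is e_0, so only its first listed column can contribute and the first bound is an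
    -- equality.
    have h3 : minorThree (catalanStieltjes r s t 0) (catalanStieltjes r s t j)
        (catalanStieltjes r s t k) l m n = catalanStieltjes r s t 0 l *
          minorTwo (catalanStieltjes r s t j) (catalanStieltjes r s t k) m n := by
      rw [minorThree, row_zero m, row_zero n, if_neg hm, if_neg hn]; ring
    rw [h3]
    refine ⟨(h.qNonneg _ _).mul (h.qNonnegMinors _ _ hjk _ _ hmn.le), ?_, ?_⟩
    · rw [sub_self]; exact QNonneg.zero
    · have h4 : catalanStieltjes r s t k n *
            minorTwo (catalanStieltjes r s t 0) (catalanStieltjes r s t j) l m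
          - catalanStieltjes r s t 0 l *
            minorTwo (catalanStieltjes r s t j) (catalanStieltjes r s t k) m n =
          catalanStieltjes r s t 0 l *
            (catalanStieltjes r s t j n * catalanStieltjes r s t k m) := by
        rw [minorTwo, minorTwo, row_zero m, if_neg hm]; ring
      rw [h4]
      exact (h.qNonneg _ _).mul ((h.qNonneg _ _).mul (h.qNonneg _ _))
  | succ i ih =>
    obtain ⟨j, rfl⟩ : ∃ j', j = j' + 1 := ⟨j - 1, by omega⟩
    obtain ⟨k, rfl⟩ : ∃ k', k = k' + 1 := ⟨k - 1, by omega⟩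
    have hij' : i < j := by omega
    have hjk' : j < k := by omega
    have hL : ∀ l m : ℕ, l < m → id l ≤ id m ∧ id l ≤ m + 1 ∧ l + 1 ≤ id m ∧ l + 1 ≤ m + 1 :=
      fun l m hlm => by simp only [id]; omega
    rw [h.row_succ, h.row_succ, h.row_succ]
    refine DominatedMinors.bidiagonal h.qNonneg_upper_diag h.qNonneg_shifted
      (fun l m hlm => by simp only [id]; omega)
      (QNonneg.bidiagonal h.qNonneg_lower_diag h.qNonneg_lower (h.qNonneg _))
      (QNonneg.bidiagonal h.qNonneg_lower_diag h.qNonneg_lower (h.qNonneg _))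
      (QNonnegMinors.bidiagonal h.qNonneg_lower_diag h.qNonneg_lower hL
        (h.qNonnegMinors _ _ hij'))
      (QNonnegMinors.bidiagonal h.qNonneg_lower_diag h.qNonneg_lower hL
        (h.qNonnegMinors _ _ hjk')) ?_
    exact DominatedMinors.bidiagonal h.qNonneg_lower_diag h.qNonneg_lower hL (h.qNonneg _)
      (h.qNonneg _) (h.qNonnegMinors _ _ hij') (h.qNonnegMinors _ _ hjk') (ih j k hij' hjk')

end BidiagonalFactorization

/-! ### The Hankel matrix as a Gram matrix -/

/-- The Hankel matrix of the Catalan-like numbers factors through the Catalan-Stieltjes matrix, with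
weights `w` such that `w 0 = 1` and `w (k + 1) * r k = w k * t (k + 1)`. -/
theorem sum_catalanStieltjes_mul {R : Type*} [CommRing R] {r s t w : ℕ → R} (h0 : w 0 = 1)
    (h : ∀ k, w (k + 1) * r k = w k * t (k + 1)) {m n N : ℕ} (hN : m + n ≤ N) :
    ∑ l ∈ Finset.range (N + 1), w l * (catalanStieltjes r s t m l * catalanStieltjes r s t n l) =
      catalanLike r s t (m + n) := by
  induction n generalizing m with
  | zero =>
    rw [Finset.sum_range_succ']
    simp [catalanStieltjes, h0, catalanLike]
  | succ n ih =>
    rw [show m + (n + 1) = m + 1 + n by omega, ← ih (by omega), eq_comm, ← sub_eq_zero,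
      ← Finset.sum_sub_distrib]
    -- Self-adjointness of T: moving one factor T from one row to the other leaves only a boundary
    -- term, which vanishes beyond the support of the rows.
    have telescope : ∀ M, ∑ l ∈ Finset.range (M + 1),
        (w l * (catalanStieltjes r s t (m + 1) l * catalanStieltjes r s t n l) -
          w l * (catalanStieltjes r s t m l * catalanStieltjes r s t (n + 1) l)) =
        w M * t (M + 1) * (catalanStieltjes r s t m (M + 1) * catalanStieltjes r s t n M -
          catalanStieltjes r s t m M * catalanStieltjes r s t n (M + 1)) := by
      intro M
      induction M with
      | zero => simp [catalanStieltjes]; ring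
      | succ M ihM =>
        rw [Finset.sum_range_succ, ihM]
        simp only [catalanStieltjes]
        linear_combination (catalanStieltjes r s t m M * catalanStieltjes r s t n (M + 1) -
          catalanStieltjes r s t m (M + 1) * catalanStieltjes r s t n M) * h M
    rw [telescope, catalanStieltjes_eq_zero_of_lt r s t m (N + 1) (by omega),
      catalanStieltjes_eq_zero_of_lt r s t n (N + 1) (by omega)]
    ring

/-! ### Gram inequalities by Cauchy–Binet -/

/-- The sum over all permutations of the three arguments. -/
def symmetrize {R : Type*} [CommRing R] (F : ℕ → ℕ → ℕ → R) (l m n : ℕ) : R :=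
  F l m n + F l n m + F m l n + F m n l + F n l m + F n m l

theorem sum_symmetrize {R : Type*} [CommRing R] (s : Finset ℕ) (F : ℕ → ℕ → ℕ → R) :
    ∑ l ∈ s, ∑ m ∈ s, ∑ n ∈ s, symmetrize F l m n =
      6 * ∑ l ∈ s, ∑ m ∈ s, ∑ n ∈ s, F l m n := by
  have swap12 : ∀ G : ℕ → ℕ → ℕ → R,
      ∑ l ∈ s, ∑ m ∈ s, ∑ n ∈ s, G m l n = ∑ l ∈ s, ∑ m ∈ s, ∑ n ∈ s, G l m n :=
    fun G => Finset.sum_comm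
  have swap23 : ∀ G : ℕ → ℕ → ℕ → R,
      ∑ l ∈ s, ∑ m ∈ s, ∑ n ∈ s, G l n m = ∑ l ∈ s, ∑ m ∈ s, ∑ n ∈ s, G l m n :=
    fun G => Finset.sum_congr rfl fun l _ => Finset.sum_comm
  simp only [symmetrize, Finset.sum_add_distrib]
  rw [swap23 F, swap12 F, (swap12 fun l m n => F l n m).trans (swap23 F),
    (swap23 fun l m n => F m l n).trans (swap12 F),
    (swap12 fun l m n => F n l m).trans
      ((swap23 fun l m n => F m l n).trans (swap12 F))]
  ring

theorem QNonneg.sum_of_symmetrize {s : Finset ℕ} {F : ℕ → ℕ → ℕ → ℝ[X]}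
    (h : ∀ l m n, l ≤ m → m ≤ n → QNonneg (symmetrize F l m n)) :
    QNonneg (∑ l ∈ s, ∑ m ∈ s, ∑ n ∈ s, F l m n) := by
  refine QNonneg.of_natCast_mul (n := 6) (by norm_num) ?_
  rw [Nat.cast_ofNat, ← sum_symmetrize]
  refine QNonneg.sum fun l => QNonneg.sum fun m => QNonneg.sum fun n => ?_
  rcases le_total l m with h1 | h1 <;> rcases le_total m n with h2 | h2 <;>
    rcases le_total l n with h3 | h3
  · exact h l m n h1 h2
  · exact h l m n h1 h2
  · convert h l n m h3 h2 using 1; simp only [symmetrize]; ring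
  · convert h n l m h3 h1 using 1; simp only [symmetrize]; ring
  · convert h m l n h1 h3 using 1; simp only [symmetrize]; ring
  · convert h m n l h2 h3 using 1; simp only [symmetrize]; ring
  · convert h n m l h2 h1 using 1; simp only [symmetrize]; ring
  · convert h n m l h2 h1 using 1; simp only [symmetrize]; ring

theorem QNonneg.sq_sub_sq {f g : ℝ[X]} (hg : QNonneg g) (h : QNonneg (f - g)) :
    QNonneg (f ^ 2 - g ^ 2) := by
  have : f ^ 2 - g ^ 2 = (f - g) * ((f - g) + g + g) := by ring
  rw [this]
  exact h.mul ((h.add hg).add hg)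

section Gram

variable {w u v x : ℕ → ℝ[X]}

/-- The bilinear form `∑ w_l u_l v_l`. -/
noncomputable def gram (w : ℕ → ℝ[X]) (N : ℕ) (u v : ℕ → ℝ[X]) : ℝ[X] :=
  ∑ l ∈ Finset.range N, w l * (u l * v l)

theorem gram_mul_mul (w : ℕ → ℝ[X]) (N : ℕ) (a b c d e f : ℕ → ℝ[X]) :
    gram w N a b * gram w N c d * gram w N e f =
      ∑ l ∈ Finset.range N, ∑ m ∈ Finset.range N, ∑ n ∈ Finset.range N,
        w l * w m * w n * ((a l * b l) * (c m * d m) * (e n * f n)) := by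
  rw [gram, gram, gram, Finset.sum_mul_sum, Finset.sum_mul]
  refine Finset.sum_congr rfl fun l _ => ?_
  rw [Finset.sum_mul_sum]
  exact Finset.sum_congr rfl fun m _ => Finset.sum_congr rfl fun n _ => by ring

/-- Cauchy–Binet; the factor 2 comes from summing over ordered pairs of columns. Exchanging the
columns changes the sign of both minors, so their product is unaffected. -/
theorem qNonneg_minor_gram (hw : ∀ l, QNonneg (w l)) (N : ℕ) (huv : QNonnegMinors u v)
    (hvx : QNonnegMinors v x) :
    QNonneg (gram w N u v * gram w N v x - gram w N u x * gram w N v v) := by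
  refine QNonneg.of_natCast_mul (n := 2) (by norm_num) ?_
  have key : ((2 : ℕ) : ℝ[X]) * (gram w N u v * gram w N v x - gram w N u x * gram w N v v) =
      ∑ l ∈ Finset.range N, ∑ m ∈ Finset.range N,
        w l * w m * (minorTwo u v l m * minorTwo v x l m) := by
    have e1 : ∀ a b c d : ℕ → ℝ[X], gram w N a b * gram w N c d =
        ∑ l ∈ Finset.range N, ∑ m ∈ Finset.range N, w l * w m * ((a l * b l) * (c m * d m)) := by
      intro a b c d
      simp only [gram, Finset.sum_mul_sum]
      exact Finset.sum_congr rfl fun l _ => Finset.sum_congr rfl fun m _ => by ring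
    have e2 : ((2 : ℕ) : ℝ[X]) * (gram w N u v * gram w N v x - gram w N u x * gram w N v v) =
        gram w N u v * gram w N v x + gram w N v x * gram w N u v -
          gram w N u x * gram w N v v - gram w N v v * gram w N u x := by
      push_cast; ring
    rw [e2]
    simp only [e1, ← Finset.sum_add_distrib, ← Finset.sum_sub_distrib]
    refine Finset.sum_congr rfl fun l _ => Finset.sum_congr rfl fun m _ => ?_
    simp only [minorTwo]; ring
  rw [key]
  refine QNonneg.sum fun l => QNonneg.sum fun m => ((hw l).mul (hw m)).mul ?_
  rcases le_total l m with h | h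
  · exact (huv _ _ h).mul (hvx _ _ h)
  · convert (huv _ _ h).mul (hvx _ _ h) using 1
    simp only [minorTwo]; ring

/-- This is G_uu (G_vv G_xx - G_vx²) - det G. At sorted columns Cauchy–Binet gives three squares
minus the square of the minor of order three, and the bound absorbs that into the first square. -/
theorem qNonneg_gram_sub_det_left (hw : ∀ l, QNonneg (w l)) (N : ℕ) (hu : ∀ l, QNonneg (u l))
    (hvx : QNonnegMinors v x) (h : DominatedMinors u v x) :
    QNonneg (gram w N x x * gram w N u v * gram w N u v
      - 2 * (gram w N v x * gram w N u x * gram w N u v)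
      + gram w N v v * gram w N u x * gram w N u x) := by
  rw [two_mul, gram_mul_mul, gram_mul_mul, gram_mul_mul]
  simp only [← Finset.sum_add_distrib, ← Finset.sum_sub_distrib]
  refine QNonneg.sum_of_symmetrize fun l m n hlm hmn => ?_
  obtain ⟨h1, h2, -⟩ := h l m n hlm hmn
  have key : symmetrize (fun l m n =>
      w l * w m * w n * (x l * x l * (u m * v m) * (u n * v n)) -
        (w l * w m * w n * (v l * x l * (u m * x m) * (u n * v n)) +
          w l * w m * w n * (v l * x l * (u m * x m) * (u n * v n))) +
        w l * w m * w n * (v l * v l * (u m * x m) * (u n * x n))) l m n =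
      w l * w m * w n * (((u l * minorTwo v x m n) ^ 2 - minorThree u v x l m n ^ 2)
        + ((u m * minorTwo v x l n) ^ 2 + (u n * minorTwo v x l m) ^ 2)) := by
    simp only [symmetrize, minorThree, minorTwo]; ring
  rw [key]
  exact (((hw l).mul (hw m)).mul (hw n)).mul ((QNonneg.sq_sub_sq h1 h2).add
    ((((hu m).mul (hvx _ _ (hlm.trans hmn))).pow 2).add (((hu n).mul (hvx _ _ hlm)).pow 2)))

/-- The mirror image, G_xx (G_uu G_vv - G_uv²) - det G, using the other bound on the minor of order
three. -/
theorem qNonneg_gram_sub_det_right (hw : ∀ l, QNonneg (w l)) (N : ℕ) (hx : ∀ l, QNonneg (x l))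
    (huv : QNonnegMinors u v) (h : DominatedMinors u v x) :
    QNonneg (gram w N u u * gram w N v x * gram w N v x
      - 2 * (gram w N v x * gram w N u x * gram w N u v)
      + gram w N v v * gram w N u x * gram w N u x) := by
  rw [two_mul, gram_mul_mul, gram_mul_mul, gram_mul_mul]
  simp only [← Finset.sum_add_distrib, ← Finset.sum_sub_distrib]
  refine QNonneg.sum_of_symmetrize fun l m n hlm hmn => ?_
  obtain ⟨h1, -, h2⟩ := h l m n hlm hmn
  have key : symmetrize (fun l m n =>
      w l * w m * w n * (u l * u l * (v m * x m) * (v n * x n)) -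
        (w l * w m * w n * (v l * x l * (u m * x m) * (u n * v n)) +
          w l * w m * w n * (v l * x l * (u m * x m) * (u n * v n))) +
        w l * w m * w n * (v l * v l * (u m * x m) * (u n * x n))) l m n =
      w l * w m * w n * (((x n * minorTwo u v l m) ^ 2 - minorThree u v x l m n ^ 2)
        + ((x m * minorTwo u v l n) ^ 2 + (x l * minorTwo u v m n) ^ 2)) := by
    simp only [symmetrize, minorThree, minorTwo]; ring
  rw [key]
  exact (((hw l).mul (hw m)).mul (hw n)).mul ((QNonneg.sq_sub_sq h1 h2).add
    ((((hx m).mul (huv _ _ (hlm.trans hmn))).pow 2).add (((hx l).mul (huv _ _ hmn)).pow 2)))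

end Gram

theorem BidiagonalFactorization.threeTermInequality {r s t α β γ δ w : ℕ → ℝ[X]}
    (h : BidiagonalFactorization r s t α β γ δ) (hw : ∀ k, QNonneg (w k)) (hw0 : w 0 = 1)
    (hrt : ∀ k, w (k + 1) * r k = w k * t (k + 1)) :
    ThreeTermInequality (catalanLike r s t) := by
  intro i j k hij hjk
  have e : ∀ m n, m ≤ k → n ≤ k → catalanLike r s t (m + n) =
      gram w (2 * k + 1) (catalanStieltjes r s t m) (catalanStieltjes r s t n) :=
    fun m n hm hn => (sum_catalanStieltjes_mul hw0 hrt (by omega)).symm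
  have hd := h.dominatedMinors i j k hij hjk
  have huv := h.qNonnegMinors i j hij
  have hvx := h.qNonnegMinors j k hjk
  -- The mixed product G_uv G_vx G_ux occurs -2 - 2 + 1 = -3 times, and G_vv G_ux² occurs 1 + 1 - 1
  -- = 1 time.
  have key := ((qNonneg_gram_sub_det_left hw (2 * k + 1) (h.qNonneg i) hvx hd).add
    (qNonneg_gram_sub_det_right hw (2 * k + 1) (h.qNonneg k) huv hd)).add
    ((QNonneg.sum (s := Finset.range (2 * k + 1)) fun l =>
      (hw l).mul ((h.qNonneg i l).mul (h.qNonneg k l))).mul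
      (qNonneg_minor_gram hw (2 * k + 1) huv hvx))
  rw [← gram] at key
  rw [QGe, sub_zero, two_mul i, two_mul j, two_mul k, add_comm k i, e i i (by omega) (by omega),
    e j j (by omega) (by omega), e k k le_rfl le_rfl, e j k (by omega) le_rfl,
    e i k (by omega) le_rfl, e i j (by omega) (by omega)]
  convert key using 1
  ring

/-! ### Eulerian polynomials -/

/-- Each column is determined by the previous one and its derivative. Column 1 can thus be
eliminated from the recurrence of column 0, which becomes the differential recurrence of the
Eulerian polynomials. -/
theorem eulerian_catalanStieltjes_derivative (n k : ℕ) :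
    ((k : ℝ[X]) + 1) * catalanStieltjes eulerianR eulerianS eulerianT n (k + 1) =
      (1 - X) * derivative (catalanStieltjes eulerianR eulerianS eulerianT n k) +
        ((n : ℝ[X]) - (k : ℝ[X])) * catalanStieltjes eulerianR eulerianS eulerianT n k := by
  induction n generalizing k with
  | zero => cases k <;> simp [catalanStieltjes]
  | succ n ih =>
    cases k with
    | zero =>
      have h0 := ih 0
      have h1 := ih 1
      simp only [catalanStieltjes, eulerianR, eulerianS, eulerianT, derivative_add,
        derivative_mul, derivative_X, derivative_one, derivative_zero, Nat.cast_add,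
        Nat.cast_one, Nat.cast_zero] at h0 h1 ⊢
      linear_combination h0 + X * h1
    | succ k =>
      have h0 := ih k
      have h1 := ih (k + 1)
      have h2 := ih (k + 2)
      simp only [catalanStieltjes, eulerianR, eulerianS, eulerianT, derivative_add,
        derivative_mul, derivative_X, derivative_one, derivative_natCast, Nat.cast_add,
        Nat.cast_one, Nat.cast_ofNat, derivative_ofNat] at h0 h1 h2 ⊢
      -- The multipliers are r_k, s_{k+1} and t_{k+2}.
      linear_combination ((k : ℝ[X]) + 1) * h0 + ((k + 1) * (X + 1) + 1) * h1 + (k + 2) * X * h2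

theorem eulerian_catalanLike_succ (n : ℕ) :
    catalanLike eulerianR eulerianS eulerianT (n + 1) =
      catalanLike eulerianR eulerianS eulerianT n * (1 - X) +
      X * (derivative (catalanLike eulerianR eulerianS eulerianT n) * (1 - X) +
        ((n : ℝ[X]) + 1) * catalanLike eulerianR eulerianS eulerianT n) := by
  have h := eulerian_catalanStieltjes_derivative n 0
  simp only [catalanLike, catalanStieltjes, eulerianS, eulerianT, Nat.cast_one, Nat.cast_zero] at h ⊢
  linear_combination X * h

theorem powerSeries_mk_pow_succ (n : ℕ) :
    (PowerSeries.mk fun k : ℕ => ((k : ℝ) + 1) ^ (n + 1)) =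
      (PowerSeries.mk fun k : ℕ => ((k : ℝ) + 1) ^ n) + PowerSeries.X *
        PowerSeries.derivative ℝ (PowerSeries.mk fun k : ℕ => ((k : ℝ) + 1) ^ n) := by
  ext k
  cases k with
  | zero => simp
  | succ m =>
    simp [PowerSeries.coeff_succ_X_mul, PowerSeries.coeff_derivative]
    ring

theorem eulerian_catalanLike_spec (n : ℕ) :
    (PowerSeries.mk fun k : ℕ => ((k : ℝ) + 1) ^ n) * (1 - PowerSeries.X) ^ (n + 1)
      = ((catalanLike eulerianR eulerianS eulerianT n : ℝ[X]) : PowerSeries ℝ) := by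
  induction n with
  | zero =>
    have h := PowerSeries.mk_one_mul_one_sub_eq_one ℝ
    simp only [catalanLike, catalanStieltjes, pow_zero, zero_add, pow_one, Polynomial.coe_one]
    exact h
  | succ n ih =>
    have h2 := congrArg (PowerSeries.derivative ℝ) ih
    rw [PowerSeries.derivative_coe] at h2
    simp only [Derivation.leibniz, Derivation.leibniz_pow, map_sub, Derivation.map_one_eq_zero,
      PowerSeries.derivative_X, smul_eq_mul, nsmul_eq_mul, Nat.add_sub_cancel] at h2
    have h3 : (((n : ℝ[X]) : ℝ[X]) : PowerSeries ℝ) = (n : PowerSeries ℝ) :=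
      map_natCast (Polynomial.coeToPowerSeries.ringHom (R := ℝ)) n
    rw [powerSeries_mk_pow_succ, eulerian_catalanLike_succ]
    push_cast at h2 ⊢
    rw [h3, ← h2, ← ih]
    ring

theorem eulerianPoly_eq_catalanLike (n : ℕ) :
    eulerianPoly n = catalanLike eulerianR eulerianS eulerianT n :=
  Polynomial.coe_injective ℝ ((eulerianPoly_spec n).symm.trans (eulerian_catalanLike_spec n))

/-! ### Ballot matrices from powers of a quadratic -/

section Ballot

variable {R : Type*} [CommRing R] (b c : R)

/-- The matrix with `r_k = 1`, `s_k = b + c`, `t_k = b c`, in terms of the coefficients of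
`((z + b)(z + c))^n`. -/
noncomputable def ballot (n k : ℕ) : R :=
  (((X + C b) * (X + C c)) ^ n).coeff (n + k) -
    b * c * (((X + C b) * (X + C c)) ^ n).coeff (n + k + 2)

theorem coeff_quadratic_mul (p : R[X]) (m : ℕ) :
    ((X + C b) * (X + C c) * p).coeff (m + 2) =
      p.coeff m + (b + c) * p.coeff (m + 1) + b * c * p.coeff (m + 2) := by
  have : (X + C b) * (X + C c) * p = X * (X * p) + C (b + c) * (X * p) + C (b * c) * p := by
    rw [C_add, C_mul]; ring
  rw [this, coeff_add, coeff_add, coeff_C_mul, coeff_C_mul, coeff_X_mul, coeff_X_mul, coeff_X_mul]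

theorem coeff_quadratic_mul_one (p : R[X]) :
    ((X + C b) * (X + C c) * p).coeff 1 = (b + c) * p.coeff 0 + b * c * p.coeff 1 := by
  have : (X + C b) * (X + C c) * p = X * (X * p) + C (b + c) * (X * p) + C (b * c) * p := by
    rw [C_add, C_mul]; ring
  rw [this, coeff_add, coeff_add, coeff_C_mul, coeff_C_mul, coeff_X_mul, coeff_X_mul]
  simp

/-- Divided by z, the quadratic is invariant under z ↦ bc/z, which relates the coefficients on
either side of the central one. -/
theorem coeff_quadratic_pow_symm [IsDomain R] [CharZero R] (n : ℕ) :
    (((X + C b) * (X + C c)) ^ (n + 1)).coeff n =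
      b * c * (((X + C b) * (X + C c)) ^ (n + 1)).coeff (n + 2) := by
  cases n with
  | zero =>
    have h := coeff_quadratic_mul b c 1 0
    simp only [mul_one, coeff_one] at h
    simp only [zero_add, pow_one] at h ⊢
    rw [h]
    simp [mul_coeff_zero]
  | succ n =>
    set P : R[X] := (X + C b) * (X + C c) with hP
    -- In P (P^{n+2})' = (n+2) P' P^{n+2}, the central coefficient of P^{n+2} cancels at degree n +
    -- 2; both neighbours carry the factor n + 3, up to bc.
    have hd : P * derivative (P ^ (n + 2)) =
        C ((n : R) + 2) * (C 2 * (X * P ^ (n + 2)) + C (b + c) * P ^ (n + 2)) := by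
      have hP' : derivative P = C 2 * X + C (b + c) := by
        rw [hP, derivative_mul]
        simp only [derivative_add, derivative_X, derivative_C, C_add, C_ofNat]; ring
      rw [derivative_pow_succ, hP']
      push_cast
      simp only [C_add, C_ofNat, C_1]
      ring
    have h := congrArg (fun p => coeff p (n + 2)) hd
    simp only [hP, coeff_quadratic_mul, coeff_derivative] at h
    simp only [← hP, coeff_C_mul, coeff_add, coeff_X_mul] at h
    have hn : ((n : R) + 3) ≠ 0 := by exact_mod_cast Nat.succ_ne_zero (n + 2)
    refine mul_left_cancel₀ hn ?_
    push_cast at h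
    simp only [show n + 1 + 1 = n + 2 from rfl, show n + 1 + 2 = n + 3 from rfl] at h ⊢
    linear_combination -h

theorem ballot_succ_succ (n k : ℕ) :
    ballot b c (n + 1) (k + 1) =
      ballot b c n k + (b + c) * ballot b c n (k + 1) + b * c * ballot b c n (k + 2) := by
  have h1 := coeff_quadratic_mul b c (((X + C b) * (X + C c)) ^ n) (n + k)
  have h2 := coeff_quadratic_mul b c (((X + C b) * (X + C c)) ^ n) (n + k + 2)
  simp only [ballot, pow_succ']
  rw [show n + 1 + (k + 1) = n + k + 2 by omega, h1, h2]
  simp only [add_assoc, Nat.reduceAdd]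
  ring

/-- The reflection principle: the general recurrence persists at k = 0 because the entry at k = -1
would vanish by the symmetry of the coefficients. -/
theorem ballot_succ_zero [IsDomain R] [CharZero R] (n : ℕ) :
    ballot b c (n + 1) 0 = (b + c) * ballot b c n 0 + b * c * ballot b c n 1 := by
  have h2 := coeff_quadratic_mul b c (((X + C b) * (X + C c)) ^ n) (n + 1)
  cases n with
  | zero =>
    simp only [ballot, pow_succ', h2, zero_add, add_zero, coeff_quadratic_mul_one]
    simp [coeff_one]
  | succ n =>
    have h1 := coeff_quadratic_mul b c (((X + C b) * (X + C c)) ^ (n + 1)) n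
    have h3 := coeff_quadratic_pow_symm b c n
    simp only [ballot, add_zero]
    rw [pow_succ' _ (n + 1), show n + 1 + 1 = n + 2 from rfl, h1, h2, h3]
    simp only [add_assoc, Nat.reduceAdd]
    ring

/-- The matrix with `r_k = 1`, `s_0 = c`, `s_k = b + c` for `k ≥ 1`, and `t_k = b c`. -/
theorem catalanStieltjes_eq_ballot [IsDomain R] [CharZero R] {r s t : ℕ → R} (hr : ∀ k, r k = 1) (hs0 : s 0 = c)
    (hs : ∀ k, s (k + 1) = b + c) (ht : ∀ k, t (k + 1) = b * c) (n : ℕ) :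
    catalanStieltjes r s t (n + 1) 0 = c * ballot b c n 0 ∧
    ∀ k, catalanStieltjes r s t (n + 1) (k + 1) = ballot b c n k + c * ballot b c n (k + 1) := by
  -- Here T = LU with L having diagonal 1 and subdiagonal b, and U having diagonal c and
  -- superdiagonal 1. The ballot matrix belongs to UL, and e_0 L = e_0, so e_0 T^{n+1} = e_0 (UL)^n
  -- U.
  induction n with
  | zero =>
    constructor
    · simp [catalanStieltjes, hs0, ballot, coeff_one]
    · intro k
      cases k <;> simp [catalanStieltjes, hr, ballot, coeff_one]
  | succ n ih =>
    obtain ⟨h0, h⟩ := ih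
    constructor
    · rw [catalanStieltjes, h0, h 0, hs0, ht 0, ballot_succ_zero]; ring
    · intro k
      cases k with
      | zero =>
        rw [catalanStieltjes, h0, h 0, h 1, hr, hs, ht 1, ballot_succ_zero, ballot_succ_succ]; ring
      | succ k =>
        rw [catalanStieltjes, h k, h (k + 1), h (k + 2), hr, hs, ht, ballot_succ_succ,
          ballot_succ_succ]
        ring

theorem coeff_quadratic_pow (n m : ℕ) :
    (((X + C b) * (X + C c)) ^ n).coeff m = ∑ i ∈ Finset.range (m + 1),
      (n.choose i * n.choose (m - i) : R) * (b ^ (n - i) * c ^ (n - (m - i))) := by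
  rw [mul_pow, coeff_mul, Finset.Nat.sum_antidiagonal_eq_sum_range_succ_mk]
  refine Finset.sum_congr rfl fun i _ => ?_
  rw [coeff_X_add_C_pow, coeff_X_add_C_pow]; ring

theorem succ_mul_choose_minor (n i : ℕ) (hi : i ≤ n) :
    ((n : ℝ) + 1) * (n.choose i * n.choose (n - i) - n.choose (i + 1) * n.choose (n + 1 - i)) =
      (n + 1).choose i * (n + 1).choose (i + 1) := by
  rw [Nat.choose_symm hi]
  have h1 : ((n + 1).choose (i + 1) : ℝ) = n.choose i + n.choose (i + 1) := by
    exact_mod_cast Nat.choose_succ_succ n i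
  have h2 : (n.choose (i + 1) : ℝ) * (i + 1) = n.choose i * (n - i) := by
    have := Nat.choose_succ_right_eq n i
    rw [← Nat.cast_sub hi]
    exact_mod_cast this
  rw [h1]
  cases i with
  | zero => simp [add_comm]
  | succ i =>
    have h3 : ((n + 1).choose (i + 1) : ℝ) = n.choose i + n.choose (i + 1) := by
      exact_mod_cast Nat.choose_succ_succ n i
    have h4 : (n.choose (i + 1) : ℝ) * (i + 1) = n.choose i * (n - i) := by
      have := Nat.choose_succ_right_eq n i
      rw [← Nat.cast_sub (by omega)]
      exact_mod_cast this
    have h5 : n.choose (n + 1 - (i + 1)) = n.choose i := by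
      rw [Nat.add_sub_add_right, Nat.choose_symm (by omega)]
    rw [h3, h5]
    push_cast at h2 ⊢
    have hn : (n : ℝ) - i ≠ 0 := by
      rw [← Nat.cast_sub (by omega)]
      exact_mod_cast (by omega : n - i ≠ 0)
    have hi' : (i : ℝ) + 2 ≠ 0 := by positivity
    -- Both outer binomials are expressed through the middle one, leaving a rational identity.
    have e1 : (n.choose i : ℝ) = n.choose (i + 1) * (i + 1) / (n - i) := by
      rw [eq_div_iff hn, h4]
    have e2 : (n.choose (i + 1 + 1) : ℝ) = n.choose (i + 1) * (n - (i + 1)) / (i + 2) := by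
      rw [eq_div_iff hi', ← h2]; ring
    rw [e1, e2]
    field_simp
    ring

end Ballot

theorem succ_mul_ballot_zero (b c : ℝ[X]) (n : ℕ) :
    ((n : ℝ[X]) + 1) * ballot b c n 0 = ∑ i ∈ Finset.range (n + 1),
      ((n + 1).choose i * (n + 1).choose (i + 1) : ℝ[X]) * (b ^ (n - i) * c ^ i) := by
  have h2 : b * c * (((X + C b) * (X + C c)) ^ n).coeff (n + 2) =
      ∑ i ∈ Finset.range (n + 1),
        (n.choose (i + 1) * n.choose (n + 1 - i) : ℝ[X]) * (b ^ (n - i) * c ^ i) := by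
    rw [coeff_quadratic_pow, Finset.sum_range_succ, Finset.sum_range_succ']
    simp only [Nat.choose_eq_zero_of_lt (show n < n + 2 by omega), Nat.cast_zero, zero_mul,
      mul_zero, add_zero, Nat.sub_zero]
    rw [Finset.mul_sum]
    refine Finset.sum_congr rfl fun i hi => ?_
    have hi' : i ≤ n := by have := Finset.mem_range.1 hi; omega
    rw [show n + 2 - (i + 1) = n + 1 - i by omega]
    -- At i = 0 and i = n an exponent is truncated, but a binomial coefficient vanishes there.
    rcases Nat.eq_zero_or_pos i with rfl | h0
    · simp
    rcases hi'.eq_or_lt with rfl | h1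
    · simp
    have e1 : b ^ (n - i) = b * b ^ (n - (i + 1)) := by
      rw [← pow_succ']; congr 1; omega
    have e2 : c ^ i = c * c ^ (n - (n + 1 - i)) := by
      rw [← pow_succ']; congr 1; omega
    rw [e1, e2]; ring
  rw [ballot, add_zero, h2, coeff_quadratic_pow, ← Finset.sum_sub_distrib, Finset.mul_sum]
  refine Finset.sum_congr rfl fun i hi => ?_
  have hi' : i ≤ n := by have := Finset.mem_range.1 hi; omega
  have h := congrArg (C : ℝ → ℝ[X]) (succ_mul_choose_minor n i hi')
  simp only [C_mul, C_add, C_sub, C_1, map_natCast] at h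
  rw [← h, show n - (n - i) = i by omega]
  ring

/-! ### Narayana and Schröder polynomials -/

theorem narayana_catalanLike_succ (n : ℕ) :
    catalanLike narayanaR narayanaS narayanaT (n + 1) = X * ballot 1 X n 0 :=
  (catalanStieltjes_eq_ballot 1 X (fun _ => rfl) rfl
    (fun k => by simp [narayanaS, add_comm]) (fun k => by simp [narayanaT]) n).1

theorem schroder_catalanLike_succ (n : ℕ) :
    catalanLike schroderR schroderS schroderT (n + 1) = (X + 1) * ballot X (X + 1) n 0 :=
  (catalanStieltjes_eq_ballot X (X + 1) (fun _ => rfl) rfl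
    (fun k => by simp [schroderS]; ring) (fun k => by simp [schroderT]) n).1

theorem narayanaPoly_eq_catalanLike (n : ℕ) :
    narayanaPoly n = catalanLike narayanaR narayanaS narayanaT n := by
  cases n with
  | zero => simp [narayanaPoly, catalanLike, catalanStieltjes]
  | succ n =>
    have hn : ((n : ℝ[X]) + 1) ≠ 0 := by exact_mod_cast Nat.succ_ne_zero n
    refine mul_left_cancel₀ hn ?_
    rw [narayana_catalanLike_succ, mul_left_comm, succ_mul_ballot_zero, narayanaPoly,
      if_neg (Nat.succ_ne_zero n), Finset.mul_sum, Finset.mul_sum,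
      Finset.range_eq_Ico, ← Finset.Ico_add_one_right_eq_Icc,
      Finset.sum_Ico_eq_sum_range, Finset.sum_Ico_eq_sum_range]
    refine Finset.sum_congr rfl fun i _ => ?_
    have hC : ((n : ℝ[X]) + 1) * C (1 / ((n + 1 : ℕ) : ℝ)) = 1 := by
      rw [← C_eq_natCast, ← C_1, ← C_add, ← C_mul]
      congr 1
      push_cast
      field_simp
    simp only [C_mul, map_natCast, Nat.add_sub_cancel, one_pow, one_mul, zero_add,
      add_comm 1 i]
    linear_combination (((n + 1).choose i : ℝ[X]) * (n + 1).choose (i + 1) * X ^ (i + 1)) * hC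

theorem succ_mul_schroder_coeff (n m : ℕ) (hm : m ≤ n + 1) :
    ((n : ℝ) + 1) * (((n + 1 + m).choose (n + 1 - m) : ℝ) * (1 / ((m : ℝ) + 1)) *
      ((2 * m).choose m : ℝ)) = (n + 1).choose m * (m + (n + 1)).choose n := by
  obtain ⟨d, hd⟩ := Nat.exists_eq_add_of_le hm
  have h1 : n + 1 + m = d + 2 * m := by omega
  have h2 : m + (n + 1) = n + (m + 1) := by omega
  have h3 : n + 1 - m = d := by omega
  rw [h3, h1, h2, two_mul, Nat.cast_add_choose, Nat.cast_add_choose, Nat.cast_add_choose, hd,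
    Nat.cast_add_choose, ← hd, show n + (m + 1) = d + (m + m) by omega, Nat.factorial_succ n,
    Nat.factorial_succ m]
  push_cast
  field_simp

/-- Vandermonde's convolution after reflecting the second binomial. -/
theorem sum_choose_mul_choose_succ (n m : ℕ) :
    ∑ j ∈ Finset.range (n + 1), m.choose j * (n + 1).choose (j + 1) =
      (m + (n + 1)).choose n := by
  rw [Nat.add_choose_eq, Finset.Nat.sum_antidiagonal_eq_sum_range_succ_mk]
  refine Finset.sum_congr rfl fun j hj => ?_
  have hj' : j ≤ n := by have := Finset.mem_range.1 hj; omega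
  rw [← Nat.choose_symm (show j + 1 ≤ n + 1 by omega), Nat.add_sub_add_right]

theorem schroderPoly_eq_catalanLike (n : ℕ) :
    schroderPoly n = catalanLike schroderR schroderS schroderT n := by
  cases n with
  | zero => simp [schroderPoly, catalanLike, catalanStieltjes]
  | succ n =>
    have hn : ((n : ℝ[X]) + 1) ≠ 0 := by exact_mod_cast Nat.succ_ne_zero n
    refine mul_left_cancel₀ hn ?_
    rw [schroder_catalanLike_succ, mul_left_comm, succ_mul_ballot_zero, ← Finset.sum_range_reflect]
    ext m
    have hC : ((n : ℝ[X]) + 1) = C ((n : ℝ) + 1) := by simp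
    rw [hC, coeff_C_mul, schroderPoly, finsetSum_coeff, Finset.mul_sum _ _ (X + 1 : ℝ[X]),
      finsetSum_coeff]
    simp only [coeff_C_mul, coeff_X_pow, mul_ite, mul_one, mul_zero, Finset.sum_ite_eq,
      Finset.mem_range]
    -- Trinomial revision replaces binom(n+1, j) binom(n+1-j, m-j) by binom(n+1, m) binom(m, j); the
    -- first factor leaves the sum and the rest is a Vandermonde sum.
    have hterm : ∀ j ∈ Finset.range (n + 1), ((X + 1) *
        (((n + 1).choose (n + 1 - 1 - j) * (n + 1).choose (n + 1 - 1 - j + 1) : ℝ[X]) *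
          (X ^ (n - (n + 1 - 1 - j)) * (X + 1) ^ (n + 1 - 1 - j)))).coeff m =
        (n + 1).choose m * (m.choose j * (n + 1).choose (j + 1) : ℝ) := by
      intro j hj
      have hj' : j ≤ n := by have := Finset.mem_range.1 hj; omega
      have e1 : (n + 1).choose (n - j) = (n + 1).choose (j + 1) := by
        rw [← Nat.choose_symm (show j + 1 ≤ n + 1 by omega), Nat.add_sub_add_right]
      have e2 : (n + 1).choose (n - j + 1) = (n + 1).choose j := by
        rw [← Nat.choose_symm (show j ≤ n + 1 by omega)]; congr 1; omega
      have e3 : (X + 1 : ℝ[X]) * (((n + 1).choose (j + 1) * (n + 1).choose j : ℝ[X]) *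
          (X ^ j * (X + 1) ^ (n - j))) =
          C (((n + 1).choose (j + 1) * (n + 1).choose j : ℕ) : ℝ) *
            (X ^ j * (X + 1) ^ (n + 1 - j)) := by
        rw [show n + 1 - j = n - j + 1 by omega, pow_succ, map_natCast]; push_cast; ring
      rw [Nat.add_sub_cancel, e1, e2, show n - (n - j) = j by omega, e3, coeff_C_mul,
        coeff_X_pow_mul']
      split_ifs with hjm
      · rw [coeff_X_add_one_pow]
        have h : ((n + 1).choose m : ℝ) * m.choose j =
            (n + 1).choose j * (n + 1 - j).choose (m - j) := by
          exact_mod_cast Nat.choose_mul (n := n + 1) hjm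
        push_cast
        linear_combination -((n + 1).choose (j + 1) : ℝ) * h
      · rw [Nat.choose_eq_zero_of_lt (show m < j by omega)]; simp
    rw [Finset.sum_congr rfl hterm, ← Finset.mul_sum]
    have hs : ∑ j ∈ Finset.range (n + 1), (m.choose j * (n + 1).choose (j + 1) : ℝ) =
        (m + (n + 1)).choose n := by exact_mod_cast sum_choose_mul_choose_succ n m
    rw [hs]
    split_ifs with hm
    · exact succ_mul_schroder_coeff n m (by omega)
    · rw [Nat.choose_eq_zero_of_lt (show n + 1 < m by omega)]; simp

/-! ### Factorizations, positivity conditions and conclusion -/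

theorem QNonneg.natCast_add_one (k : ℕ) : QNonneg ((k : ℝ[X]) + 1) :=
  (QNonneg.natCast k).add QNonneg.one

theorem QNonneg.X_add_one : QNonneg (Polynomial.X + 1 : ℝ[X]) := QNonneg.X.add QNonneg.one

/-- Equality holds in condition (A), so the lower factor can carry r_k and t_{k+1} while every
nonzero entry of the upper factor is 1. -/
theorem eulerian_bidiagonalFactorization :
    BidiagonalFactorization eulerianR eulerianS eulerianT (fun k => (k : ℝ[X]) + 1)
      (fun k => ((k : ℝ[X]) + 1) * X) (fun _ => 1) (fun _ => 1) where
  qNonneg_lower_diag := QNonneg.natCast_add_one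
  qNonneg_lower k := (QNonneg.natCast_add_one k).mul QNonneg.X
  qNonneg_upper_diag _ := QNonneg.one
  qNonneg_upper _ := QNonneg.one
  r_eq k := by simp [eulerianR]
  s_zero := by simp [eulerianS]
  s_succ k := by simp [eulerianS]; ring
  t_succ k := by simp [eulerianT]

theorem schroder_bidiagonalFactorization :
    BidiagonalFactorization schroderR schroderS schroderT (fun _ => 1) (fun _ => X)
      (fun _ => X + 1) (fun _ => 1) where
  qNonneg_lower_diag _ := QNonneg.one
  qNonneg_lower _ := QNonneg.X
  qNonneg_upper_diag _ := QNonneg.X_add_one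
  qNonneg_upper _ := QNonneg.one
  r_eq k := by simp [schroderR]
  s_zero := by simp [schroderS]
  s_succ k := by simp [schroderS]; ring
  t_succ k := by simp [schroderT]

theorem narayana_bidiagonalFactorization :
    BidiagonalFactorization narayanaR narayanaS narayanaT (fun _ => 1) (fun _ => 1)
      (fun _ => X) (fun _ => 1) where
  qNonneg_lower_diag _ := QNonneg.one
  qNonneg_lower _ := QNonneg.one
  qNonneg_upper_diag _ := QNonneg.X
  qNonneg_upper _ := QNonneg.one
  r_eq k := by simp [narayanaR]
  s_zero := by simp [narayanaS]
  s_succ k := by simp [narayanaS]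
  t_succ k := by simp [narayanaT]

theorem BidiagonalFactorization.qNonnegParams {r s t α β γ δ : ℕ → ℝ[X]}
    (h : BidiagonalFactorization r s t α β γ δ) : QNonnegParams r s t := by
  refine ⟨fun k => ?_, fun k => ?_, fun k hk => ?_⟩
  · rw [h.r_eq]
    exact (h.qNonneg_lower_diag k).mul (h.qNonneg_upper k)
  · cases k with
    | zero =>
      rw [h.s_zero]
      exact (h.qNonneg_lower_diag 0).mul (h.qNonneg_upper_diag 0)
    | succ k =>
      rw [h.s_succ]
      exact ((h.qNonneg_lower_diag _).mul (h.qNonneg_upper_diag _)).add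
        ((h.qNonneg_lower k).mul (h.qNonneg_upper k))
  · obtain ⟨k, rfl⟩ : ∃ k', k = k' + 1 := ⟨k - 1, by omega⟩
    rw [h.t_succ]
    exact (h.qNonneg_lower k).mul (h.qNonneg_upper_diag k)

/-- A factorization with trivial diagonal and superdiagonal gives condition (D), with `b_0 = 0`. -/
theorem BidiagonalFactorization.positivityConditionD {r s t β γ : ℕ → ℝ[X]}
    (h : BidiagonalFactorization r s t (fun _ => 1) β γ (fun _ => 1)) :
    PositivityConditionD r s t := by
  refine ⟨fun k => if k = 0 then 0 else β (k - 1), γ, fun k => ?_, h.qNonneg_upper_diag,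
    fun k => ⟨by rw [h.r_eq, one_mul], ?_, by simp [h.t_succ]⟩⟩
  · dsimp only
    split_ifs
    exacts [QNonneg.zero, h.qNonneg_lower _]
  · cases k with
    | zero => simp [h.s_zero]
    | succ k => simp [h.s_succ, add_comm]

theorem QGe.of_eq {f g : ℝ[X]} (h : f = g) : QGe f g := h ▸ qGe_self f

theorem eulerian_positivityConditionA :
    PositivityConditionA eulerianR eulerianS eulerianT :=
  ⟨.of_eq (by simp [eulerianR, eulerianS]), fun k _ =>
    .of_eq (by simp only [eulerianR, eulerianS, eulerianT]; ring)⟩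

theorem narayana_positivityConditionB :
    PositivityConditionB narayanaR narayanaS narayanaT :=
  ⟨.of_eq rfl, fun k hk => .of_eq (by
    simp only [narayanaR, narayanaS, narayanaT, if_neg (Nat.one_le_iff_ne_zero.1 hk)]; ring)⟩

theorem narayana_positivityConditionC :
    PositivityConditionC narayanaR narayanaS narayanaT :=
  ⟨.of_eq (by simp [narayanaR, narayanaS, narayanaT]), fun k hk => .of_eq (by
    simp only [narayanaR, narayanaS, narayanaT, if_neg (Nat.one_le_iff_ne_zero.1 hk)]; ring)⟩

theorem eulerian_threeTermInequality : ThreeTermInequality eulerianPoly := by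
  rw [funext eulerianPoly_eq_catalanLike]
  -- The weights are powers of q because t_{k+1} = q r_k.
  exact eulerian_bidiagonalFactorization.threeTermInequality (w := fun k => X ^ k)
    QNonneg.X.pow (pow_zero _) fun k => by simp only [eulerianR, eulerianT]; push_cast; ring

theorem schroder_threeTermInequality : ThreeTermInequality schroderPoly := by
  rw [funext schroderPoly_eq_catalanLike]
  exact schroder_bidiagonalFactorization.threeTermInequality (w := fun k => (X * (X + 1)) ^ k)
    (QNonneg.X.mul QNonneg.X_add_one).pow (pow_zero _) fun k => by
      simp only [schroderR, schroderT]; ring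

theorem narayana_threeTermInequality : ThreeTermInequality narayanaPoly := by
  rw [funext narayanaPoly_eq_catalanLike]
  exact narayana_bidiagonalFactorization.threeTermInequality (w := fun k => X ^ k)
    QNonneg.X.pow (pow_zero _) fun k => by simp only [narayanaR, narayanaT]; ring

theorem mainTheorem6 :
    -- Eulerian polynomials
    ((∀ n, eulerianPoly n = catalanLike eulerianR eulerianS eulerianT n) ∧
      QNonnegParams eulerianR eulerianS eulerianT ∧
      PositivityConditionA eulerianR eulerianS eulerianT ∧
      ThreeTermInequality eulerianPoly) ∧
    -- Schröder polynomials
    ((∀ n, schroderPoly n = catalanLike schroderR schroderS schroderT n) ∧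
      QNonnegParams schroderR schroderS schroderT ∧
      PositivityConditionD schroderR schroderS schroderT ∧
      ThreeTermInequality schroderPoly) ∧
    -- Narayana polynomials of type A
    ((∀ n, narayanaPoly n = catalanLike narayanaR narayanaS narayanaT n) ∧
      QNonnegParams narayanaR narayanaS narayanaT ∧
      PositivityConditionB narayanaR narayanaS narayanaT ∧
      PositivityConditionC narayanaR narayanaS narayanaT ∧
      PositivityConditionD narayanaR narayanaS narayanaT ∧
      ThreeTermInequality narayanaPoly) := by
  exact ⟨⟨eulerianPoly_eq_catalanLike, eulerian_bidiagonalFactorization.qNonnegParams,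
      eulerian_positivityConditionA, eulerian_threeTermInequality⟩,
    ⟨schroderPoly_eq_catalanLike, schroder_bidiagonalFactorization.qNonnegParams,
      schroder_bidiagonalFactorization.positivityConditionD, schroder_threeTermInequality⟩,
    ⟨narayanaPoly_eq_catalanLike, narayana_bidiagonalFactorization.qNonnegParams,
      narayana_positivityConditionB, narayana_positivityConditionC,
      narayana_bidiagonalFactorization.positivityConditionD, narayana_threeTermInequality⟩⟩
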